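/- Let $K\ge 1$ be an integer, let $\rho\in(-1,1)$ and $\delta>0$ be real, with $\delta$ an integer if $\rho<0$, and let $P_k>0$ and $\sigma_k>0$ for $k=1,\dots,K$. Let $\alpha_0,\alpha_1,\dots,\alpha_K$ be independent circularly-symmetric complex normal random variables with zero mean and unit variance ($\mathcal{CN}(0,1)$), and let $$\gamma_k=P_k|h_k|^2,\qquad h_k=\sigma_k\Big(\sqrt{1-\rho^{2(k+\delta-1)}}\,\alpha_k+\rho^{k+\delta-1}\alpha_0\Big),\qquad k=1,\dots,K,$$ be the SNRs of the exponentially correlated Rayleigh channel. Put $G=\prod_{k=1}^K(1+\gamma_k)$ and, for $k=1,\dots,K$, $$\Omega_k=P_k\sigma_k^2\big(1-\rho^{2(k+\delta-1)}\big),\qquad a_k=\frac{\rho^{2(k+\delta-1)}}{1-\rho^{2(k+\delta-1)}},\qquad w_k=a_k\Big(1+\sum_{\iota=1}^K a_\iota\Big)^{-1}.$$ For $\mathbf l=(l_1,\dots,l_K)\in\mathbb N_0^K$ let $\mathcal A_{\mathbf l}=\prod_{k=1}^K(1+R_{\mathbf l,k})$, where $R_{\mathbf l,1},\dots,R_{\mathbf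 l,K}$ are independent and $R_{\mathbf l,k}$ has the Gamma distribution with shape $1+l_k$ and scale $\Omega_k$, and let $$W_{\mathbf l}=\Big(1+\sum_{k=1}^K a_k\Big)^{-1}\Big(\sum_{k=1}^K l_k\Big)!\,\prod_{k=1}^K\frac{w_k^{l_k}}{l_k!}.$$ Then $G$ and every $\mathcal A_{\mathbf l}$ have probability density functions $f_G$ and $f_{\mathcal A_{\mathbf l}}$ with respect to Lebesgue measure, and for almost every $x\in\mathbb R$ $$f_G(x)=\sum_{\mathbf l\in\mathbb N_0^K}W_{\mathbf l}\,f_{\mathcal A_{\mathbf l}}(x).$$ Moreover $w_k\ge 0$ for all $k$, $\sum_{k=1}^K w_k<1$, and $(W_{\mathbf l})_{\mathbf l\in\mathbb N_0^K}$ is the probability mass function of the negative multinomial distribution $\mathrm{NM}(1,\mathbf w)$ with $\mathbf w=(w_1,\dots,w_K)$, that is, $$W_{\mathbf l}=\frac{\Gamma\big(1+\sum_k l_k\big)}{\Gamma(1)}\Big(1-\sum_{k=1}^K w_k\Big)\prod_{k=1}^K\frac{w_k^{l_k}}{l_k!}\ge 0,\qquad \sum_{\mathbf l\in\mathbb N_0^K}W_{\mathbf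 l}=1.$$ -/

import Mathlib

open MeasureTheory ProbabilityTheory
open scoped Nat

namespace CorrRayleigh

/-- The circularly-symmetric complex normal law `CN(0,1)` (zero mean, `E|α|² = 1`): real and
imaginary parts are independent real Gaussians with mean `0` and variance `1/2`. -/
noncomputable def complexNormal : Measure ℂ :=
  ((gaussianReal 0 (1 / 2)).prod (gaussianReal 0 (1 / 2))).map
    (fun z : ℝ × ℝ => (⟨z.1, z.2⟩ : ℂ))

/-- The exponent `k + δ - 1` of the `k`-th transmission, `k = 1, …, K`; the index `k : Fin K`
starts at `0`, so that it stands for the transmission number `k + 1`. -/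
def lag {K : ℕ} (δ : ℝ) (k : Fin K) : ℝ := ((k : ℕ) + 1 : ℝ) + δ - 1

/-- The exponentially correlated Rayleigh channel coefficient
`h_k = σ_k (√(1 - ρ^{2(k+δ-1)}) α_k + ρ^{k+δ-1} α_0)`. -/
noncomputable def channel {K : ℕ} {S : Type*} (ρ δ : ℝ) (σ : Fin K → ℝ)
    (α : Fin (K + 1) → S → ℂ) (k : Fin K) (s : S) : ℂ :=
  (σ k : ℂ) * ((Real.sqrt (1 - ρ ^ (2 * lag δ k)) : ℂ) * α k.succ s
    + ((ρ ^ lag δ k : ℝ) : ℂ) * α 0 s)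

/-- The received SNR `γ_k = P_k |h_k|²`. -/
noncomputable def snr {K : ℕ} {S : Type*} (ρ δ : ℝ) (σ p : Fin K → ℝ)
    (α : Fin (K + 1) → S → ℂ) (k : Fin K) (s : S) : ℝ :=
  p k * ‖channel ρ δ σ α k s‖ ^ 2

/-- `G = ∏_k (1 + γ_k)`. -/
noncomputable def snrProd {K : ℕ} {S : Type*} (ρ δ : ℝ) (σ p : Fin K → ℝ)
    (α : Fin (K + 1) → S → ℂ) (s : S) : ℝ :=
  ∏ k, (1 + snr ρ δ σ p α k s)

/-- The scale `Ω_k = P_k σ_k² (1 - ρ^{2(k+δ-1)})`. -/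
noncomputable def scale {K : ℕ} (ρ δ : ℝ) (σ p : Fin K → ℝ) (k : Fin K) : ℝ :=
  p k * σ k ^ 2 * (1 - ρ ^ (2 * lag δ k))

/-- The joint law of independent `R_{l,k} ~ Gamma(shape 1 + l_k, scale Ω_k)`, `k = 1, …, K`.
Mathlib's `gammaMeasure` takes the shape and the rate, which is the inverse of the scale. -/
noncomputable def gammaLaw {K : ℕ} (Ω : Fin K → ℝ) (l : Fin K → ℕ) : Measure (Fin K → ℝ) :=
  Measure.pi fun k => gammaMeasure (1 + (l k : ℝ)) (Ω k)⁻¹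

/-- `A = ∏_k (1 + R_k)` as a function of `(R_1, …, R_K)`. -/
def shiftedProd {K : ℕ} (r : Fin K → ℝ) : ℝ := ∏ k, (1 + r k)

/-- `f_{A_l}`: the PDF of the product of the independent shifted Gamma variables
`1 + R_{l,k}`. -/
noncomputable def pdfA {K : ℕ} (Ω : Fin K → ℝ) (l : Fin K → ℕ) (x : ℝ) : ℝ :=
  (pdf (shiftedProd (K := K)) (gammaLaw Ω l) volume x).toReal

/-- `ρ^{2(k+δ-1)} / (1 - ρ^{2(k+δ-1)})`. -/
noncomputable def ratio {K : ℕ} (ρ δ : ℝ) (k : Fin K) : ℝ :=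
  ρ ^ (2 * lag δ k) / (1 - ρ ^ (2 * lag δ k))

/-- The parameters `w_k`. -/
noncomputable def w {K : ℕ} (ρ δ : ℝ) (k : Fin K) : ℝ :=
  ratio ρ δ k * (1 + ∑ i : Fin K, ratio ρ δ i)⁻¹

/-- The weights `W_l`. -/
noncomputable def W {K : ℕ} (ρ δ : ℝ) (l : Fin K → ℕ) : ℝ :=
  (1 + ∑ k : Fin K, ratio ρ δ k)⁻¹ * ((∑ k, l k)! : ℝ) * ∏ k, w ρ δ k ^ l k / ((l k)! : ℝ)

/-- The probability mass function of the negative multinomial law `NM(r, q)`, with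
`q_0 = 1 - ∑ q_k`:
`l ↦ Γ(r + ∑ l_k) / Γ(r) * q_0^r * ∏ q_k^{l_k} / l_k!`. -/
noncomputable def negMultinomial {K : ℕ} (r : ℝ) (q : Fin K → ℝ) (l : Fin K → ℕ) : ℝ :=
  Real.Gamma (r + ∑ k, (l k : ℝ)) / Real.Gamma r * (1 - ∑ k, q k) ^ r *
    ∏ k, q k ^ l k / ((l k)! : ℝ)

end CorrRayleigh

/-! ### Characteristic functions and the Poisson mixture of Gamma laws -/

namespace CorrRayleigh

open Complex Set Filter Topology

/-! The only dependence between the SNRs comes from `α 0`. Given `α 0 = z`, they are independent,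
and `γ_k = Ω_k |α_k + c_k z|²` with `c_k² = a_k` is a scaled noncentral chi-squared variable. Its
law is a Poisson(`a_k |z|²`) mixture of the laws Gamma(`1 + n`, `Ω_k`), by comparison of
characteristic functions (`map_normSq_complexNormal`). A product of mixtures is a mixture over
multi-indices (`pi_sum_smul`), and only the Poisson weights depend on `z`. Since `|α 0|²` is
exponential, averaging these weights is a Gamma integral with value `W_l`
(`lintegral_prod_poissonWeight`). Hence the joint law of the SNRs is a mixture of the laws
`gammaLaw` (`map_snr_eq_sum_gammaLaw`).

Pushing forward along `shiftedProd` preserves the mixture. The components are absolutely continuous,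
so the identity of measures becomes an almost everywhere identity of densities, and comparing total
masses gives `∑ W_l = 1`. -/

lemma integrableOn_pow_mul_cexp_neg_mul_Ioi (n : ℕ) {z : ℂ} (hz : 0 < z.re) :
    IntegrableOn (fun x : ℝ ↦ (x : ℂ) ^ n * cexp (-(z * x))) (Ioi 0) := by
  have h := integrableOn_rpow_mul_exp_neg_mul_rpow (p := 1) (s := n) (b := z.re)
    (by linarith [(Nat.cast_nonneg n : (0 : ℝ) ≤ n)]) one_pos hz
  refine Integrable.mono' h (Measurable.aestronglyMeasurable (by fun_prop)) ?_
  filter_upwards [ae_restrict_mem measurableSet_Ioi] with x hx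
  have hx' : (0 : ℝ) ≤ x := le_of_lt hx
  simp [Complex.norm_exp, abs_of_nonneg hx']

/-- Integration by parts: `x ^ (n + 1) * exp (-z x)` vanishes at both ends, so its derivative
integrates to zero, which links consecutive exponents. -/
lemma integral_pow_mul_cexp_neg_mul_Ioi (n : ℕ) {z : ℂ} (hz : 0 < z.re) :
    ∫ x : ℝ in Ioi 0, (x : ℂ) ^ n * cexp (-(z * x)) = n ! / z ^ (n + 1) := by
  have hz0 : z ≠ 0 := by rintro rfl; simp at hz
  induction n with
  | zero =>
    have h := integral_exp_mul_complex_Ioi (a := -z) (by simpa) 0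
    simp only [neg_mul, ofReal_zero, mul_zero, Complex.exp_zero] at h
    simpa [neg_div_neg_eq] using h
  | succ n ih =>
    have hderiv : ∀ x : ℝ, HasDerivAt (fun x : ℝ ↦ (x : ℂ) ^ (n + 1) * cexp (-(z * x)))
        ((n + 1) * ((x : ℂ) ^ n * cexp (-(z * x))) -
          z * ((x : ℂ) ^ (n + 1) * cexp (-(z * x)))) x := by
      intro x
      have h1 : HasDerivAt (fun y : ℂ ↦ y ^ (n + 1) * cexp (-(z * y)))
          (((n + 1 : ℕ) : ℂ) * (x : ℂ) ^ n * cexp (-(z * x)) +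
            (x : ℂ) ^ (n + 1) * (cexp (-(z * x)) * -(z * 1))) (x : ℂ) := by
        exact (hasDerivAt_pow (n + 1) (x : ℂ)).mul
          ((((hasDerivAt_id' (x : ℂ)).const_mul z).neg).cexp)
      convert h1.comp_ofReal using 1
      push_cast
      ring
    have hlim : Tendsto (fun x : ℝ ↦ (x : ℂ) ^ (n + 1) * cexp (-(z * x))) atTop (𝓝 0) := by
      rw [tendsto_zero_iff_norm_tendsto_zero]
      refine (tendsto_rpow_mul_exp_neg_mul_atTop_nhds_zero (n + 1 : ℕ) z.re hz).congr' ?_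
      filter_upwards [eventually_ge_atTop 0] with x hx
      rw [Real.rpow_natCast]
      simp [Complex.norm_exp, abs_of_nonneg hx]
    have i1 := (integrableOn_pow_mul_cexp_neg_mul_Ioi n hz).const_mul ((n : ℂ) + 1)
    have i2 := (integrableOn_pow_mul_cexp_neg_mul_Ioi (n + 1) hz).const_mul z
    have h := integral_Ioi_of_hasDerivAt_of_tendsto' (a := 0) (fun x _ ↦ hderiv x)
      (i1.sub i2) hlim
    rw [integral_sub i1 i2, integral_const_mul, integral_const_mul, ih] at h
    simp only [ofReal_zero, ne_eq, Nat.add_eq_zero_iff, one_ne_zero, and_false,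
      not_false_eq_true, zero_pow, zero_mul, sub_zero] at h
    rw [eq_div_iff (by positivity), pow_succ' z, ← mul_assoc, mul_comm _ z,
      ← sub_eq_zero.mp h, Nat.factorial_succ]
    push_cast
    field_simp

lemma charFun_gammaMeasure_natCast (n : ℕ) {r : ℝ} (hr : 0 < r) (t : ℝ) :
    charFun (gammaMeasure (1 + n) r) t = (r / (r - t * I)) ^ (n + 1) := by
  have hz : 0 < ((r : ℂ) - t * I).re := by simpa
  rw [charFun_apply_real, gammaMeasure, integral_withDensity_eq_integral_toReal_smul
    (by unfold gammaPDF; fun_prop) (by simp [gammaPDF])]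
  have : ∀ x : ℝ, (gammaPDF (1 + n) r x).toReal • cexp (t * x * I) =
      (Ici (0 : ℝ)).indicator (fun x : ℝ ↦ ((r : ℂ) ^ (n + 1) / n !) *
        ((x : ℂ) ^ n * cexp (-((r - t * I) * x)))) x := by
    intro x
    rw [gammaPDF, ENNReal.toReal_ofReal (gammaPDFReal_nonneg (by positivity) hr x), gammaPDFReal]
    by_cases hx : 0 ≤ x
    · rw [if_pos hx, indicator_of_mem (by exact hx), add_comm (1 : ℝ), Real.Gamma_nat_eq_factorial,
        add_sub_cancel_right, Real.rpow_natCast]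
      have : (r : ℝ) ^ ((n : ℝ) + 1) = r ^ (n + 1) := by exact_mod_cast Real.rpow_natCast r (n + 1)
      rw [this, real_smul]
      push_cast
      rw [mul_assoc, mul_assoc, ← Complex.exp_add]
      congr 3
      ring
    · rw [if_neg hx, indicator_of_notMem (by exact hx), zero_smul]
  simp_rw [this]
  rw [integral_indicator measurableSet_Ici, integral_Ici_eq_integral_Ioi, integral_const_mul,
    integral_pow_mul_cexp_neg_mul_Ioi n hz]
  have : (n ! : ℂ) ≠ 0 := by exact_mod_cast n.factorial_ne_zero
  rw [div_pow]
  field_simp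

lemma integral_cexp_sq_gaussianReal (τ m : ℝ) :
    ∫ x, cexp (τ * (x + m) ^ 2 * I) ∂(gaussianReal 0 (1 / 2)) =
      (√Real.pi : ℂ)⁻¹ * ((Real.pi : ℂ) / (1 - τ * I)) ^ (1 / 2 : ℂ) *
        cexp (m ^ 2 * (τ * I / (1 - τ * I))) := by
  rw [integral_gaussianReal_eq_integral_smul (by norm_num)]
  have hb : ((τ : ℂ) * I - 1).re < 0 := by simp
  have hne : (1 - (τ : ℂ) * I) ≠ 0 := by
    intro h; have := congrArg re h; simp at this
  have hne' : ((τ : ℂ) * I - 1) ≠ 0 := by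
    intro h; have := congrArg re h; simp at this
  have : ∀ x : ℝ, gaussianPDFReal 0 (1 / 2) x • cexp (τ * (x + m) ^ 2 * I) =
      (√Real.pi : ℂ)⁻¹ *
        cexp ((τ * I - 1) * x ^ 2 + (2 * τ * m * I) * x + τ * m ^ 2 * I) := by
    intro x
    have h2 : 2 * Real.pi * ((1 / 2 : NNReal) : ℝ) = Real.pi := by push_cast; ring
    rw [gaussianPDFReal, real_smul, h2]
    push_cast
    rw [mul_assoc, ← Complex.exp_add]
    congr 2
    simp
    ring
  simp_rw [this]
  rw [integral_const_mul, integral_cexp_quadratic hb, ← mul_assoc, neg_sub]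
  congr 2
  field_simp
  ring

lemma integral_cexp_normSq_complexNormal (τ : ℝ) (m : ℂ) :
    ∫ u, cexp (τ * (‖u + m‖ ^ 2 : ℝ) * I) ∂complexNormal =
      (1 - τ * I)⁻¹ * cexp (‖m‖ ^ 2 * (τ * I / (1 - τ * I))) := by
  have hpi : (Real.pi : ℂ) ≠ 0 := by exact_mod_cast Real.pi_ne_zero
  have hmeas : Measurable fun z : ℝ × ℝ ↦ (⟨z.1, z.2⟩ : ℂ) :=
    measurableEquivRealProd.symm.measurable
  rw [complexNormal, integral_map hmeas.aemeasurable
    (Measurable.aestronglyMeasurable (by fun_prop))]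
  have : ∀ z : ℝ × ℝ, cexp (τ * (‖(⟨z.1, z.2⟩ : ℂ) + m‖ ^ 2 : ℝ) * I) =
      cexp (τ * (z.1 + m.re) ^ 2 * I) * cexp (τ * (z.2 + m.im) ^ 2 * I) := by
    intro z
    rw [← Complex.exp_add, Complex.sq_norm, normSq_apply]
    congr 1
    simp
    ring
  simp_rw [this]
  rw [integral_prod_mul (fun x : ℝ ↦ cexp (τ * (x + m.re) ^ 2 * I))
    (fun x : ℝ ↦ cexp (τ * (x + m.im) ^ 2 * I)), integral_cexp_sq_gaussianReal,
    integral_cexp_sq_gaussianReal]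
  -- The real and imaginary parts contribute the same complex square root; only its square occurs,
  -- so the choice of branch is immaterial.
  have hroot : (((Real.pi : ℂ) / (1 - τ * I)) ^ (1 / 2 : ℂ)) ^ 2 = Real.pi / (1 - τ * I) := by
    rw [one_div]
    exact_mod_cast cpow_nat_inv_pow _ two_ne_zero
  have hsqrt : (√Real.pi : ℂ) ^ 2 = Real.pi := by exact_mod_cast Real.sq_sqrt Real.pi_pos.le
  have hnorm : (‖m‖ : ℂ) ^ 2 = m.re ^ 2 + m.im ^ 2 := by
    have := Complex.sq_norm m
    rw [normSq_apply] at this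
    exact_mod_cast this.trans (by ring)
  rw [hnorm, add_mul, Complex.exp_add]
  calc _ = ((√Real.pi : ℂ) ^ 2)⁻¹ * (((Real.pi : ℂ) / (1 - τ * I)) ^ (1 / 2 : ℂ)) ^ 2 *
        (cexp (m.re ^ 2 * (τ * I / (1 - τ * I))) * cexp (m.im ^ 2 * (τ * I / (1 - τ * I)))) := by
        ring
    _ = _ := by
        rw [hroot, hsqrt]
        field_simp

instance : IsProbabilityMeasure complexNormal := by
  unfold complexNormal
  exact Measure.isProbabilityMeasure_map
    (measurableEquivRealProd.symm.measurable).aemeasurable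

lemma isProbabilityMeasure_gammaMeasure_natCast (n : ℕ) {Ω : ℝ} (hΩ : 0 < Ω) :
    IsProbabilityMeasure (gammaMeasure (1 + n) Ω⁻¹) :=
  isProbabilityMeasure_gammaMeasure (by positivity) (inv_pos.mpr hΩ)

/-- The Poisson weight `e^{-r} r^n / n!`. -/
noncomputable def poissonWeight (r : ℝ) (n : ℕ) : ℝ := Real.exp (-r) * (r ^ n / n !)

lemma poissonWeight_nonneg {r : ℝ} (hr : 0 ≤ r) (n : ℕ) : 0 ≤ poissonWeight r n := by
  unfold poissonWeight; positivity

lemma hasSum_poissonWeight (r : ℝ) : HasSum (poissonWeight r) 1 := by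
  have h := (NormedSpace.expSeries_div_hasSum_exp r).mul_left (Real.exp (-r))
  rwa [← Real.exp_eq_exp_ℝ, ← Real.exp_add, neg_add_cancel, Real.exp_zero] at h

/-- The noncentral chi-squared law with two degrees of freedom is a Poisson mixture of Gamma
laws. -/
lemma map_normSq_complexNormal {Ω : ℝ} (hΩ : 0 < Ω) (m : ℂ) :
    complexNormal.map (fun u ↦ Ω * ‖u + m‖ ^ 2) =
      Measure.sum fun n : ℕ ↦
        ENNReal.ofReal (poissonWeight (‖m‖ ^ 2) n) • gammaMeasure (1 + n) Ω⁻¹ := by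
  have hprob := fun n ↦ isProbabilityMeasure_gammaMeasure_natCast n hΩ
  -- Characteristic functions determine finite measures only, so finiteness of the mixture is
  -- established first.
  have hw := poissonWeight_nonneg (sq_nonneg ‖m‖)
  have : IsFiniteMeasure (Measure.sum fun n : ℕ ↦
      ENNReal.ofReal (poissonWeight (‖m‖ ^ 2) n) • gammaMeasure (1 + n) Ω⁻¹) := by
    refine ⟨?_⟩
    rw [Measure.sum_apply _ MeasurableSet.univ]
    simp only [Measure.smul_apply, measure_univ, smul_eq_mul, mul_one]
    exact (hasSum_poissonWeight _).summable.tsum_ofReal_lt_top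
  refine Measure.ext_of_charFun ?_
  ext t
  have hint : Integrable (fun x : ℝ ↦ cexp (t * x * I)) (Measure.sum fun n : ℕ ↦
      ENNReal.ofReal (poissonWeight (‖m‖ ^ 2) n) • gammaMeasure (1 + n) Ω⁻¹) := by
    refine Integrable.of_bound (Measurable.aestronglyMeasurable (by fun_prop)) 1 (ae_of_all _ ?_)
    intro x
    rw [← ofReal_mul, norm_exp_ofReal_mul_I]
  rw [charFun_apply_real, charFun_apply_real, integral_map
    (Measurable.aemeasurable (by fun_prop)) (Measurable.aestronglyMeasurable (by fun_prop)),
    ← (hasSum_integral_measure hint).tsum_eq]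
  have hL : ∀ u : ℂ, cexp (t * (Ω * ‖u + m‖ ^ 2 : ℝ) * I) =
      cexp ((t * Ω : ℝ) * (‖u + m‖ ^ 2 : ℝ) * I) := by
    intro u; push_cast; ring_nf
  simp_rw [hL]
  rw [integral_cexp_normSq_complexNormal]
  have hne : (1 - ((t * Ω : ℝ) : ℂ) * I) ≠ 0 := by
    intro h; have := congrArg re h; simp at this
  symm
  refine HasSum.tsum_eq ?_
  -- With `τ = t Ω`, `τ I / (1 - τ I) = q - 1`. The left side is thus `q exp (-‖m‖²) exp (‖m‖² q)`,
  -- and the mixture is the power series of the last exponential.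
  set q : ℂ := (1 - ((t * Ω : ℝ) : ℂ) * I)⁻¹ with hq
  have hR : ∀ n : ℕ, ∫ x : ℝ, cexp (t * x * I)
      ∂(ENNReal.ofReal (poissonWeight (‖m‖ ^ 2) n) • gammaMeasure (1 + n) Ω⁻¹) =
      cexp (-(‖m‖ ^ 2)) * q * ((‖m‖ ^ 2 * q) ^ n / n !) := by
    intro n
    rw [integral_smul_measure, ← charFun_apply_real,
      charFun_gammaMeasure_natCast n (inv_pos.mpr hΩ), ENNReal.toReal_ofReal (hw n), real_smul]
    have : ((Ω⁻¹ : ℝ) : ℂ) / ((Ω⁻¹ : ℝ) - t * I) = q := by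
      have hΩ' : (Ω : ℂ) ≠ 0 := by exact_mod_cast hΩ.ne'
      rw [hq]
      push_cast at hne ⊢
      have : (Ω : ℂ)⁻¹ - t * I = (Ω : ℂ)⁻¹ * (1 - t * Ω * I) := by field_simp
      rw [this]
      field_simp
    rw [this, poissonWeight]
    push_cast
    ring
  simp_rw [hR]
  have h := (NormedSpace.expSeries_div_hasSum_exp ((‖m‖ : ℂ) ^ 2 * q)).mul_left
    (cexp (-(‖m‖ ^ 2)) * q)
  rw [← Complex.exp_eq_exp_ℂ] at h
  convert h using 1 <;> try rfl
  rw [mul_comm _ q, mul_assoc, ← Complex.exp_add]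
  congr 2
  rw [hq]
  field_simp
  ring

end CorrRayleigh

/-! ### Products, pushforwards and densities of countable mixtures -/

namespace CorrRayleigh

open Set Filter Topology

lemma prod_tsum_eq_tsum_prod {K : ℕ} (f : Fin K → ℕ → ENNReal) :
    ∏ k, ∑' n, f k n = ∑' l : Fin K → ℕ, ∏ k, f k (l k) := by
  induction K with
  | zero => simp
  | succ K ih =>
    rw [Fin.prod_univ_succ, ih, ← (Fin.consEquiv fun _ ↦ ℕ).tsum_eq, ENNReal.tsum_prod',
      ← ENNReal.tsum_mul_right]
    refine tsum_congr fun n ↦ ?_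
    rw [← ENNReal.tsum_mul_left]
    refine tsum_congr fun l ↦ ?_
    simp [Fin.prod_univ_succ, Fin.consEquiv]

/-- A product measure is determined by its values on boxes, where the claim is distributivity of a
finite product over infinite sums in `ENNReal`. -/
lemma pi_sum_smul {K : ℕ} {X : Type*} [MeasurableSpace X] (c : Fin K → ℕ → ENNReal)
    (ν : Fin K → ℕ → Measure X) [∀ k n, SigmaFinite (ν k n)]
    [∀ k, SigmaFinite (Measure.sum fun n ↦ c k n • ν k n)] :
    Measure.pi (fun k ↦ Measure.sum fun n ↦ c k n • ν k n) =
      Measure.sum fun l : Fin K → ℕ ↦ (∏ k, c k (l k)) • Measure.pi fun k ↦ ν k (l k) := by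
  refine Measure.pi_eq fun s hs ↦ ?_
  rw [Measure.sum_apply _ (MeasurableSet.univ_pi hs)]
  simp_rw [Measure.sum_apply _ (hs _), Measure.smul_apply, Measure.pi_pi, smul_eq_mul]
  rw [prod_tsum_eq_tsum_prod]
  simp_rw [Finset.prod_mul_distrib]

lemma measurable_shiftedProd {K : ℕ} : Measurable (shiftedProd (K := K)) := by
  unfold shiftedProd; fun_prop

lemma gammaMeasure_absolutelyContinuous (a r : ℝ) : gammaMeasure a r ≪ volume :=
  withDensity_absolutelyContinuous _ _

/-- The law of `(1 + R_1) ⋯ (1 + R_K)` is absolutely continuous if each of the independent `R_k`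
has an absolutely continuous law. -/
lemma map_shiftedProd_pi_absolutelyContinuous {K : ℕ} (hK : 1 ≤ K) (ν : Fin K → Measure ℝ)
    [∀ k, SigmaFinite (ν k)] (hν : ∀ k, ν k ≪ volume) :
    (Measure.pi ν).map (shiftedProd (K := K)) ≪ volume := by
  -- One factor is split off. For `K = 0` the empty product is constant and has no density.
  obtain ⟨K, rfl⟩ : ∃ n, K = n + 1 := ⟨K - 1, by omega⟩
  refine Measure.AbsolutelyContinuous.mk fun N hN hN0 ↦ ?_
  rw [Measure.map_apply measurable_shiftedProd hN]
  have hmp := (measurePreserving_piFinSuccAbove ν 0).symm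
  rw [← hmp.measure_preimage (measurable_shiftedProd hN).nullMeasurableSet]
  have hmeas : MeasurableSet ((MeasurableEquiv.piFinSuccAbove (fun _ ↦ ℝ) 0).symm ⁻¹'
      (shiftedProd (K := K + 1) ⁻¹' N)) :=
    (MeasurableEquiv.measurable _) (measurable_shiftedProd hN)
  rw [Measure.prod_apply_symm hmeas, lintegral_eq_zero_iff (measurable_measure_prodMk_right hmeas)]
  -- Almost surely the other factors have a nonzero product, so the product is an affine function of
  -- the first variable with nonzero slope, and preimages of null sets are null.
  have hne : ∀ᵐ y ∂(Measure.pi fun j ↦ ν (Fin.succAbove 0 j)), ∀ j, y j ≠ -1 :=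
    ae_all_iff.mpr fun j ↦ (Measure.quasiMeasurePreserving_eval
      (fun j ↦ ν (Fin.succAbove 0 j)) j).ae ((hν (Fin.succAbove 0 j)).ae_le
        (Measure.ae_ne volume (-1)))
  filter_upwards [hne] with y hy
  have hc : ∏ j, (1 + y j) ≠ 0 :=
    Finset.prod_ne_zero_iff.mpr fun j _ h ↦ hy j (by linarith)
  have hpre : (fun x ↦ (x, y)) ⁻¹' ((MeasurableEquiv.piFinSuccAbove (fun _ ↦ ℝ) 0).symm ⁻¹'
      (shiftedProd (K := K + 1) ⁻¹' N)) = (fun x ↦ 1 + x) ⁻¹' ((· * ∏ j, (1 + y j)) ⁻¹' N) := by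
    ext x
    simp [shiftedProd, MeasurableEquiv.piFinSuccAbove, Fin.prod_univ_succ]
  rw [hpre]
  refine hν 0 ?_
  rw [measure_preimage_add, Real.volume_preimage_mul_right hc, hN0, mul_zero]

/-- Density of a countable mixture. -/
lemma hasSum_toReal_rnDeriv_sum {ι : Type*} [Countable ι] (c : ι → ℝ) (hc : ∀ i, 0 ≤ c i)
    (ν : ι → Measure ℝ) [∀ i, IsFiniteMeasure (ν i)] (hν : ∀ i, ν i ≪ volume)
    (η : Measure ℝ) [IsFiniteMeasure η]
    (h : η = Measure.sum fun i ↦ ENNReal.ofReal (c i) • ν i) :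
    ∀ᵐ x, HasSum (fun i ↦ c i * ((ν i).rnDeriv volume x).toReal)
      (η.rnDeriv volume x).toReal := by
  have hmeas : ∀ i, Measurable (fun x ↦ ENNReal.ofReal (c i) * (ν i).rnDeriv volume x) :=
    fun i ↦ (Measure.measurable_rnDeriv _ _).const_mul _
  have hη : η = volume.withDensity
      (fun x ↦ ∑' i, ENNReal.ofReal (c i) * (ν i).rnDeriv volume x) := by
    have : (fun x ↦ ∑' i, ENNReal.ofReal (c i) * (ν i).rnDeriv volume x) =
        ∑' i, fun x ↦ ENNReal.ofReal (c i) * (ν i).rnDeriv volume x := by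
      ext x
      rw [tsum_apply (Pi.summable.mpr fun _ ↦ ENNReal.summable)]
    rw [this, withDensity_tsum hmeas, h]
    congr 1
    ext1 i
    change _ = volume.withDensity (ENNReal.ofReal (c i) • (ν i).rnDeriv volume)
    rw [withDensity_smul _ (Measure.measurable_rnDeriv _ _),
      Measure.withDensity_rnDeriv_eq _ _ (hν i)]
  have hrn : η.rnDeriv volume =ᵐ[volume]
      fun x ↦ ∑' i, ENNReal.ofReal (c i) * (ν i).rnDeriv volume x := by
    conv_lhs => rw [hη]
    exact Measure.rnDeriv_withDensity _ (Measurable.tsum hmeas)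
  -- The density of the finite measure `η` is finite almost everywhere; at such points the `ENNReal`
  -- series is a convergent real series.
  filter_upwards [hrn, Measure.rnDeriv_lt_top η volume] with x hx hlt
  rw [hx] at hlt ⊢
  have := ENNReal.hasSum_toReal hlt.ne
  rw [← ENNReal.tsum_toReal_eq (ENNReal.ne_top_of_tsum_ne_top hlt.ne)] at this
  simpa [ENNReal.toReal_mul, ENNReal.toReal_ofReal (hc _)] using this

end CorrRayleigh

/-! ### Averaging over the common component and the negative multinomial weights -/

namespace CorrRayleigh

open Set Filter Topology

lemma map_sq_norm_complexNormal : complexNormal.map (fun u ↦ ‖u‖ ^ 2) = gammaMeasure 1 1 := by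
  have h := map_normSq_complexNormal one_pos 0
  simp only [one_mul, add_zero, norm_zero, inv_one] at h
  rw [h]
  ext s hs
  rw [Measure.sum_apply _ hs, tsum_eq_single 0]
  · simp [poissonWeight]
  · intro n hn
    simp [poissonWeight, hn]

/-- Mixing Poisson weights of intensities `a_k t` over an exponential `t` gives the negative
multinomial weights. -/
lemma lintegral_prod_poissonWeight {K : ℕ} {a : Fin K → ℝ} (ha : ∀ k, 0 ≤ a k) (l : Fin K → ℕ) :
    ∫⁻ t, ∏ k, ENNReal.ofReal (poissonWeight (a k * t) (l k)) ∂(gammaMeasure 1 1) =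
      ENNReal.ofReal ((1 + ∑ k, a k)⁻¹ * (∑ k, l k)! *
        ∏ k, (a k * (1 + ∑ i, a i)⁻¹) ^ l k / (l k)!) := by
  set A := 1 + ∑ k, a k with hA
  have hA0 : 0 < A := by
    have := Finset.sum_nonneg fun k (_ : k ∈ Finset.univ) ↦ ha k
    linarith
  set C : ℝ := A⁻¹ * (∑ k, l k)! * ∏ k, (a k * A⁻¹) ^ l k / (l k)! with hC
  have hC0 : 0 ≤ C := by
    have : ∀ k, 0 ≤ (a k * A⁻¹) ^ l k / ((l k)! : ℝ) := fun k ↦ by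
      have := ha k
      positivity
    have := Finset.prod_nonneg fun k (_ : k ∈ Finset.univ) ↦ this k
    positivity
  have hpw : Measurable fun t : ℝ ↦ ∏ k, ENNReal.ofReal (poissonWeight (a k * t) (l k)) := by
    unfold poissonWeight; fun_prop
  rw [gammaMeasure, lintegral_withDensity_eq_lintegral_mul _
    (by unfold gammaPDF; fun_prop) hpw]
  -- Up to the constant `C`, the factor `exp (-t)` times the Poisson weights is the Gamma density of
  -- shape `∑ l_k + 1` and rate `A`, whose integral is one.
  have hpt : ∀ t, (gammaPDF 1 1 * fun t ↦ ∏ k, ENNReal.ofReal (poissonWeight (a k * t) (l k))) t =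
      ENNReal.ofReal C * gammaPDF ((∑ k, l k : ℕ) + 1) A t := by
    intro t
    rw [Pi.mul_apply]
    rcases lt_or_ge t 0 with ht | ht
    · simp [gammaPDF_of_neg ht]
    · rw [gammaPDF_of_nonneg ht, gammaPDF_of_nonneg ht, ← ENNReal.ofReal_mul hC0,
        ← ENNReal.ofReal_prod_of_nonneg
          (fun k _ ↦ poissonWeight_nonneg (mul_nonneg (ha k) ht) _),
        ← ENNReal.ofReal_mul (by positivity)]
      congr 1
      have hr : A ^ (((∑ k, l k : ℕ) : ℝ) + 1) = A ^ (∑ k, l k) * A := by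
        rw [Real.rpow_add_one hA0.ne', Real.rpow_natCast]
      have h1 : ∏ k, poissonWeight (a k * t) (l k) =
          Real.exp (-((∑ k, a k) * t)) * (t ^ (∑ k, l k) * ∏ k, a k ^ l k / (l k)!) := by
        simp_rw [poissonWeight, mul_pow]
        rw [Finset.prod_mul_distrib, ← Real.exp_sum, Finset.sum_mul, Finset.sum_neg_distrib,
          ← Finset.prod_pow_eq_pow_sum, ← Finset.prod_mul_distrib]
        congr 1
        exact Finset.prod_congr rfl fun k _ ↦ by ring
      have h2 : ∏ k, (a k * A⁻¹) ^ l k / ((l k)! : ℝ) =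
          (A ^ (∑ k, l k))⁻¹ * ∏ k, a k ^ l k / (l k)! := by
        rw [← inv_pow, ← Finset.prod_pow_eq_pow_sum, ← Finset.prod_mul_distrib]
        exact Finset.prod_congr rfl fun k _ ↦ by ring
      have h3 : Real.exp (-(A * t)) = Real.exp (-(1 * t)) * Real.exp (-((∑ k, a k) * t)) := by
        rw [← Real.exp_add, hA]
        congr 1
        ring
      rw [hC, h1, h2, h3, hr, Real.Gamma_nat_eq_factorial, add_sub_cancel_right,
        Real.rpow_natCast]
      have : ((∑ k, l k)! : ℝ) ≠ 0 := by exact_mod_cast Nat.factorial_ne_zero _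
      have hA' : A ≠ 0 := hA0.ne'
      simp only [Real.one_rpow, Real.Gamma_one, sub_self, Real.rpow_zero]
      field_simp
  rw [lintegral_congr hpt, lintegral_const_mul _ (by unfold gammaPDF; fun_prop),
    lintegral_gammaPDF_eq_one (by positivity) hA0, mul_one]

lemma lag_pos {K : ℕ} {δ : ℝ} (hδ : 0 < δ) (k : Fin K) : 0 < lag δ k := by
  have : (0 : ℝ) ≤ (k : ℕ) := Nat.cast_nonneg _
  unfold lag
  linarith

/-- For negative `ρ` this rule fails for general real exponents; an integer `δ` makes the lag a
natural number. -/
lemma rpow_two_mul_lag {K : ℕ} {ρ δ : ℝ} (hρδ : 0 ≤ ρ ∨ ∃ n : ℕ, δ = n) (k : Fin K) :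
    ρ ^ (2 * lag δ k) = (ρ ^ lag δ k) ^ 2 := by
  rcases hρδ with h | ⟨n, rfl⟩
  · rw [mul_comm, Real.rpow_mul h, Real.rpow_two]
  · have h1 : lag (n : ℝ) k = ((k + n : ℕ) : ℝ) := by unfold lag; push_cast; ring
    have h2 : 2 * lag (n : ℝ) k = ((2 * (k + n) : ℕ) : ℝ) := by rw [h1]; push_cast; ring
    rw [h2, h1, Real.rpow_natCast, Real.rpow_natCast, mul_comm, pow_mul]

lemma rpow_two_mul_lag_lt_one {K : ℕ} {ρ δ : ℝ} (hρ : |ρ| < 1) (hδ : 0 < δ)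
    (hρδ : 0 ≤ ρ ∨ ∃ n : ℕ, δ = n) (k : Fin K) : ρ ^ (2 * lag δ k) < 1 := by
  rw [rpow_two_mul_lag hρδ, sq_lt_one_iff_abs_lt_one]
  exact (Real.abs_rpow_le_abs_rpow _ _).trans_lt
    (Real.rpow_lt_one (abs_nonneg _) hρ (lag_pos hδ k))

lemma ratio_nonneg {K : ℕ} {ρ δ : ℝ} (hρ : |ρ| < 1) (hδ : 0 < δ)
    (hρδ : 0 ≤ ρ ∨ ∃ n : ℕ, δ = n) (k : Fin K) : 0 ≤ ratio ρ δ k := by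
  have h := rpow_two_mul_lag_lt_one hρ hδ hρδ k
  unfold ratio
  refine div_nonneg ?_ (by linarith)
  rw [rpow_two_mul_lag hρδ]
  positivity

lemma one_add_sum_ratio_pos {K : ℕ} {ρ δ : ℝ} (hρ : |ρ| < 1) (hδ : 0 < δ)
    (hρδ : 0 ≤ ρ ∨ ∃ n : ℕ, δ = n) : 0 < 1 + ∑ k : Fin K, ratio ρ δ k := by
  have := Finset.sum_nonneg fun k (_ : k ∈ (Finset.univ : Finset (Fin K))) ↦
    ratio_nonneg hρ hδ hρδ k
  linarith

lemma w_nonneg {K : ℕ} {ρ δ : ℝ} (hρ : |ρ| < 1) (hδ : 0 < δ)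
    (hρδ : 0 ≤ ρ ∨ ∃ n : ℕ, δ = n) (k : Fin K) : 0 ≤ w ρ δ k :=
  mul_nonneg (ratio_nonneg hρ hδ hρδ k) (inv_nonneg.mpr (one_add_sum_ratio_pos hρ hδ hρδ).le)

lemma one_sub_sum_w {K : ℕ} {ρ δ : ℝ} (hρ : |ρ| < 1) (hδ : 0 < δ)
    (hρδ : 0 ≤ ρ ∨ ∃ n : ℕ, δ = n) :
    1 - ∑ k : Fin K, w ρ δ k = (1 + ∑ k : Fin K, ratio ρ δ k)⁻¹ := by
  have := one_add_sum_ratio_pos (K := K) hρ hδ hρδ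
  simp_rw [w]
  rw [← Finset.sum_mul]
  field_simp
  ring

lemma W_nonneg {K : ℕ} {ρ δ : ℝ} (hρ : |ρ| < 1) (hδ : 0 < δ)
    (hρδ : 0 ≤ ρ ∨ ∃ n : ℕ, δ = n) (l : Fin K → ℕ) : 0 ≤ W ρ δ l := by
  have h := one_add_sum_ratio_pos (K := K) hρ hδ hρδ
  refine mul_nonneg (by positivity) (Finset.prod_nonneg fun k _ ↦ ?_)
  have := w_nonneg hρ hδ hρδ k
  positivity

lemma W_eq_negMultinomial {K : ℕ} {ρ δ : ℝ} (hρ : |ρ| < 1) (hδ : 0 < δ)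
    (hρδ : 0 ≤ ρ ∨ ∃ n : ℕ, δ = n) (l : Fin K → ℕ) :
    W ρ δ l = negMultinomial 1 (w ρ δ) l := by
  have h : Real.Gamma (1 + ∑ k, (l k : ℝ)) = (∑ k, l k)! := by
    rw [add_comm, ← Nat.cast_sum, Real.Gamma_nat_eq_factorial]
  rw [W, negMultinomial, one_sub_sum_w hρ hδ hρδ, h, Real.Gamma_one, Real.rpow_one, div_one,
    mul_comm (_⁻¹)]

lemma scale_pos {K : ℕ} {ρ δ : ℝ} (hρ : |ρ| < 1) (hδ : 0 < δ)
    (hρδ : 0 ≤ ρ ∨ ∃ n : ℕ, δ = n) {σ p : Fin K → ℝ} (hσ : ∀ k, 0 < σ k) (hp : ∀ k, 0 < p k)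
    (k : Fin K) : 0 < scale ρ δ σ p k := by
  have h := rpow_two_mul_lag_lt_one hρ hδ hρδ k
  have := hσ k
  have := hp k
  have : 0 < 1 - ρ ^ (2 * lag δ k) := by linarith
  unfold scale
  positivity

/-- The correlation coefficient of `α_0` relative to that of `α_k`. -/
noncomputable def shiftCoeff {K : ℕ} (ρ δ : ℝ) (k : Fin K) : ℝ :=
  ρ ^ lag δ k / √(1 - ρ ^ (2 * lag δ k))

lemma sq_shiftCoeff {K : ℕ} {ρ δ : ℝ} (hρ : |ρ| < 1) (hδ : 0 < δ)
    (hρδ : 0 ≤ ρ ∨ ∃ n : ℕ, δ = n) (k : Fin K) : shiftCoeff ρ δ k ^ 2 = ratio ρ δ k := by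
  have h := rpow_two_mul_lag_lt_one hρ hδ hρδ k
  rw [shiftCoeff, div_pow, Real.sq_sqrt (by linarith), ratio, rpow_two_mul_lag hρδ]

lemma snr_eq {K : ℕ} {S : Type*} {ρ δ : ℝ} (hρ : |ρ| < 1) (hδ : 0 < δ)
    (hρδ : 0 ≤ ρ ∨ ∃ n : ℕ, δ = n) (σ p : Fin K → ℝ) (α : Fin (K + 1) → S → ℂ) (k : Fin K)
    (s : S) : snr ρ δ σ p α k s =
      scale ρ δ σ p k * ‖α k.succ s + (shiftCoeff ρ δ k : ℂ) * α 0 s‖ ^ 2 := by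
  have h : 0 < 1 - ρ ^ (2 * lag δ k) := by linarith [rpow_two_mul_lag_lt_one hρ hδ hρδ k]
  have hb : (√(1 - ρ ^ (2 * lag δ k)) : ℂ) ≠ 0 := by
    exact_mod_cast (Real.sqrt_pos.mpr h).ne'
  have hch : channel ρ δ σ α k s = ((σ k * √(1 - ρ ^ (2 * lag δ k)) : ℝ) : ℂ) *
      (α k.succ s + (shiftCoeff ρ δ k : ℂ) * α 0 s) := by
    unfold channel shiftCoeff
    push_cast
    field_simp
  rw [snr, hch, norm_mul, mul_pow, Complex.norm_real, Real.norm_eq_abs, sq_abs, mul_pow,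
    Real.sq_sqrt h.le, scale]
  ring

/-- The joint law of the SNRs is a negative multinomial mixture of products of Gamma laws. -/
lemma map_snr_eq_sum_gammaLaw {S : Type*} [MeasurableSpace S] (μ : Measure S)
    [IsProbabilityMeasure μ] {K : ℕ} {ρ δ : ℝ} (hρ : |ρ| < 1) (hδ : 0 < δ)
    (hρδ : 0 ≤ ρ ∨ ∃ n : ℕ, δ = n) {σ p : Fin K → ℝ} (hσ : ∀ k, 0 < σ k) (hp : ∀ k, 0 < p k)
    {α : Fin (K + 1) → S → ℂ} (hα : ∀ i, HasLaw (α i) complexNormal μ) (hind : iIndepFun α μ) :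
    μ.map (fun s k ↦ snr ρ δ σ p α k s) =
      Measure.sum fun l : Fin K → ℕ ↦
        ENNReal.ofReal (W ρ δ l) • gammaLaw (scale ρ δ σ p) l := by
  have hΩ := scale_pos hρ hδ hρδ hσ hp
  have hprob := fun k n ↦ isProbabilityMeasure_gammaMeasure_natCast n (hΩ k)
  set g : ℂ → (Fin K → ℂ) → Fin K → ℝ := fun z x k ↦
    scale ρ δ σ p k * ‖x k + (shiftCoeff ρ δ k : ℂ) * z‖ ^ 2 with hg
  have hgm : Measurable (Function.uncurry g) := by
    rw [hg]; unfold Function.uncurry; fun_prop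
  have hlaw : HasLaw (fun s ↦ (α 0 s, fun k : Fin K ↦ α k.succ s))
      (complexNormal.prod (Measure.pi fun _ : Fin K ↦ complexNormal)) μ := by
    have h1 := hind.hasLaw_pi hα
    exact (measurePreserving_piFinSuccAbove
      (fun _ : Fin (K + 1) ↦ complexNormal) 0).comp_hasLaw h1
  -- Conditional law of the SNRs given `α 0 = z`.
  have hcond : ∀ z, (Measure.pi fun _ : Fin K ↦ complexNormal).map (g z) =
      Measure.sum fun l : Fin K → ℕ ↦
        (∏ k, ENNReal.ofReal (poissonWeight (ratio ρ δ k * ‖z‖ ^ 2) (l k))) •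
          gammaLaw (scale ρ δ σ p) l := by
    intro z
    have hk : ∀ k, complexNormal.map (fun u ↦
        scale ρ δ σ p k * ‖u + (shiftCoeff ρ δ k : ℂ) * z‖ ^ 2) =
        Measure.sum fun n : ℕ ↦ ENNReal.ofReal (poissonWeight (ratio ρ δ k * ‖z‖ ^ 2) n) •
          gammaMeasure (1 + n) (scale ρ δ σ p k)⁻¹ := by
      intro k
      rw [map_normSq_complexNormal (hΩ k), norm_mul, mul_pow, Complex.norm_real,
        Real.norm_eq_abs, sq_abs, sq_shiftCoeff hρ hδ hρδ]
    have hfin : ∀ k, IsProbabilityMeasure (complexNormal.map (fun u ↦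
        scale ρ δ σ p k * ‖u + (shiftCoeff ρ δ k : ℂ) * z‖ ^ 2)) := fun k ↦
      Measure.isProbabilityMeasure_map (Measurable.aemeasurable (by fun_prop))
    have hpi := Measure.pi_map_pi (μ := fun _ : Fin K ↦ complexNormal)
      (f := fun k u ↦ scale ρ δ σ p k * ‖u + (shiftCoeff ρ δ k : ℂ) * z‖ ^ 2)
      (fun k ↦ Measurable.aemeasurable (by fun_prop))
    rw [hg, hpi]
    have : ∀ k, SigmaFinite (Measure.sum fun n : ℕ ↦
        ENNReal.ofReal (poissonWeight (ratio ρ δ k * ‖z‖ ^ 2) n) •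
          gammaMeasure (1 + n) (scale ρ δ σ p k)⁻¹) := fun k ↦ by
      rw [← hk k]; infer_instance
    simp_rw [hk]
    exact pi_sum_smul (fun k n ↦ ENNReal.ofReal (poissonWeight (ratio ρ δ k * ‖z‖ ^ 2) n))
      (fun k n ↦ gammaMeasure (1 + n) (scale ρ δ σ p k)⁻¹)
  -- The weights depend on `z` only through `‖z‖ ^ 2`, which is exponential with rate one.
  have hmix : ∀ l : Fin K → ℕ, ∫⁻ z, ∏ k, ENNReal.ofReal
      (poissonWeight (ratio ρ δ k * ‖z‖ ^ 2) (l k)) ∂complexNormal = ENNReal.ofReal (W ρ δ l) := by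
    intro l
    have := lintegral_prod_poissonWeight (ratio_nonneg hρ hδ hρδ) l
    rw [← map_sq_norm_complexNormal, lintegral_map (by unfold poissonWeight; fun_prop)
      (by fun_prop)] at this
    exact this
  have hsnr : (fun s k ↦ snr ρ δ σ p α k s) =
      Function.uncurry g ∘ fun s ↦ (α 0 s, fun k : Fin K ↦ α k.succ s) := by
    ext s k
    exact snr_eq hρ hδ hρδ σ p α k s
  rw [hsnr, ← AEMeasurable.map_map_of_aemeasurable hgm.aemeasurable hlaw.aemeasurable, hlaw.map_eq]
  ext B hB
  rw [Measure.map_apply hgm hB, Measure.prod_apply (hgm hB), Measure.sum_apply _ hB]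
  have hslice : ∀ z, (Measure.pi fun _ : Fin K ↦ complexNormal)
      (Prod.mk z ⁻¹' (Function.uncurry g ⁻¹' B)) =
      ∑' l : Fin K → ℕ, (∏ k, ENNReal.ofReal (poissonWeight (ratio ρ δ k * ‖z‖ ^ 2) (l k))) *
        gammaLaw (scale ρ δ σ p) l B := by
    intro z
    have h := congrArg (fun η ↦ η B) (hcond z)
    have hgz : Measurable (g z) := hgm.comp measurable_prodMk_left
    rw [Measure.map_apply hgz hB, Measure.sum_apply _ hB] at h
    exact h
  simp_rw [hslice]
  have hm : ∀ l : Fin K → ℕ, Measurable fun z : ℂ ↦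
      ∏ k, ENNReal.ofReal (poissonWeight (ratio ρ δ k * ‖z‖ ^ 2) (l k)) := fun l ↦ by
    unfold poissonWeight; fun_prop
  rw [lintegral_tsum fun l ↦ ((hm l).mul_const _).aemeasurable]
  refine tsum_congr fun l ↦ ?_
  rw [lintegral_mul_const _ (hm l), hmix]
  rfl

end CorrRayleigh

/-! ### Passage from the joint law to the density of the product -/

theorem theorem1 {S : Type*} [MeasurableSpace S] (μ : Measure S) [IsProbabilityMeasure μ]
    (K : ℕ) (hK : 1 ≤ K) (ρ δ : ℝ) (hρ : |ρ| < 1) (hδ : 0 < δ)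
    (hρδ : 0 ≤ ρ ∨ ∃ n : ℕ, δ = n)
    (σ p : Fin K → ℝ) (hσ : ∀ k, 0 < σ k) (hp : ∀ k, 0 < p k)
    (α : Fin (K + 1) → S → ℂ)
    (hα : ∀ i, HasLaw (α i) CorrRayleigh.complexNormal μ) (hind : iIndepFun α μ) :
    -- `G` and every `A_l` have a probability density function
    HasPDF (CorrRayleigh.snrProd ρ δ σ p α) μ volume ∧
    (∀ l : Fin K → ℕ, HasPDF (CorrRayleigh.shiftedProd (K := K))
      (CorrRayleigh.gammaLaw (CorrRayleigh.scale ρ δ σ p) l) volume) ∧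
    -- the density of `G` is the mixture of those of the `A_l` with weights `W_l`
    (∀ᵐ x : ℝ, HasSum
      (fun l : Fin K → ℕ =>
        CorrRayleigh.W ρ δ l * CorrRayleigh.pdfA (CorrRayleigh.scale ρ δ σ p) l x)
      (pdf (CorrRayleigh.snrProd ρ δ σ p α) μ volume x).toReal) ∧
    -- the weights are the probability mass function of `NM(1, w)`
    (∀ k : Fin K, 0 ≤ CorrRayleigh.w ρ δ k) ∧
    (∑ k : Fin K, CorrRayleigh.w ρ δ k) < 1 ∧
    (∀ l : Fin K → ℕ,
      CorrRayleigh.W ρ δ l = CorrRayleigh.negMultinomial 1 (CorrRayleigh.w ρ δ) l) ∧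
    (∀ l : Fin K → ℕ, 0 ≤ CorrRayleigh.W ρ δ l) ∧
    HasSum (fun l : Fin K → ℕ => CorrRayleigh.W ρ δ l) 1 := by
  have hΩ := CorrRayleigh.scale_pos hρ hδ hρδ hσ hp
  have hprob := fun k n ↦ CorrRayleigh.isProbabilityMeasure_gammaMeasure_natCast n (hΩ k)
  have hlawprob : ∀ l, IsProbabilityMeasure
      (CorrRayleigh.gammaLaw (CorrRayleigh.scale ρ δ σ p) l) := fun l ↦ by
    unfold CorrRayleigh.gammaLaw; infer_instance
  have hW := CorrRayleigh.W_nonneg (K := K) hρ hδ hρδ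
  have hjoint := CorrRayleigh.map_snr_eq_sum_gammaLaw μ hρ hδ hρδ hσ hp hα hind
  have hac : ∀ l, (CorrRayleigh.gammaLaw (CorrRayleigh.scale ρ δ σ p) l).map
      (CorrRayleigh.shiftedProd (K := K)) ≪ volume := fun l ↦
    CorrRayleigh.map_shiftedProd_pi_absolutelyContinuous hK _
      fun k ↦ CorrRayleigh.gammaMeasure_absolutelyContinuous _ _
  have hsnr : AEMeasurable (fun s k ↦ CorrRayleigh.snr ρ δ σ p α k s) μ := by
    have := fun i ↦ (hα i).aemeasurable
    unfold CorrRayleigh.snr CorrRayleigh.channel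
    fun_prop
  have hG : CorrRayleigh.snrProd ρ δ σ p α =
      CorrRayleigh.shiftedProd ∘ fun s k ↦ CorrRayleigh.snr ρ δ σ p α k s := rfl
  have hGm : AEMeasurable (CorrRayleigh.snrProd ρ δ σ p α) μ := by
    rw [hG]
    exact CorrRayleigh.measurable_shiftedProd.comp_aemeasurable hsnr
  have hlawG : μ.map (CorrRayleigh.snrProd ρ δ σ p α) = Measure.sum fun l : Fin K → ℕ ↦
      ENNReal.ofReal (CorrRayleigh.W ρ δ l) •
        (CorrRayleigh.gammaLaw (CorrRayleigh.scale ρ δ σ p) l).map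
          (CorrRayleigh.shiftedProd (K := K)) := by
    rw [hG, ← AEMeasurable.map_map_of_aemeasurable
      CorrRayleigh.measurable_shiftedProd.aemeasurable hsnr, hjoint,
      Measure.map_sum CorrRayleigh.measurable_shiftedProd.aemeasurable]
    simp_rw [Measure.map_smul]
  have hprobA : ∀ l, IsProbabilityMeasure ((CorrRayleigh.gammaLaw
      (CorrRayleigh.scale ρ δ σ p) l).map (CorrRayleigh.shiftedProd (K := K))) := fun l ↦
    Measure.isProbabilityMeasure_map CorrRayleigh.measurable_shiftedProd.aemeasurable
  have hprobG := Measure.isProbabilityMeasure_map hGm (μ := μ)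
  -- Each component and the law of `G` have mass one, so evaluating the mixture on the whole line
  -- gives the sum of the weights.
  have hsum : HasSum (fun l : Fin K → ℕ ↦ CorrRayleigh.W ρ δ l) 1 := by
    have h := congrArg (fun η : Measure ℝ ↦ η Set.univ) hlawG
    simp only [measure_univ, Measure.sum_apply _ MeasurableSet.univ, Measure.smul_apply,
      smul_eq_mul, mul_one] at h
    have hs := ENNReal.hasSum_toReal (h ▸ ENNReal.one_ne_top)
    rw [← ENNReal.tsum_toReal_eq (fun _ ↦ ENNReal.ofReal_ne_top), ← h, ENNReal.toReal_one] at hs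
    simpa only [ENNReal.toReal_ofReal (hW _)] using hs
  refine ⟨⟨hGm, inferInstance, ?_⟩,
    fun l ↦ ⟨CorrRayleigh.measurable_shiftedProd.aemeasurable, inferInstance, hac l⟩,
    CorrRayleigh.hasSum_toReal_rnDeriv_sum _ hW _ hac _ hlawG,
    CorrRayleigh.w_nonneg hρ hδ hρδ, ?_, CorrRayleigh.W_eq_negMultinomial hρ hδ hρδ, hW, hsum⟩
  · rw [hlawG]
    exact Measure.absolutelyContinuous_sum_left fun l ↦ (hac l).smul_left _
  · have h := CorrRayleigh.one_sub_sum_w (K := K) hρ hδ hρδ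
    have := inv_pos.mpr (CorrRayleigh.one_add_sum_ratio_pos (K := K) hρ hδ hρδ)
    linarith
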